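/- Setting. Let $\mathcal X$ and $\Phi$ be Polish spaces with their Borel $\sigma$-algebras, let $\mathcal Y=\mathcal X\times\Phi$ carry the product $\sigma$-algebra, and fix a Polish topology on $\mathcal Y$ that generates this $\sigma$-algebra. Let $d\colon\mathcal Y\times\mathcal Y\to[0,\infty)$ be distance-like: symmetric, with $d(x,y)=0$ if and only if $x=y$, and lower semicontinuous for the product topology. For probability measures $\mu_1,\mu_2$ on $\mathcal Y$ put $\mathcal W(\mu_1,\mu_2)=\inf_\xi\int d(x,y)\,\xi(\mathrm dx,\mathrm dy)$, the infimum being over all couplings $\xi$ of $\mu_1,\mu_2$, and for a transition kernel $P$ on $\mathcal Y$ put $\tau(P)=\sup_{y_1\ne y_2}\mathcal W(P(y_1,\cdot),P(y_2,\cdot))/d(y_1,y_2)$. Let $\mathcal I$ be a measurable space, let $(P_\gamma)_{\gamma\in\mathcal I}$ be Markov kernels on $\mathcal Y$ that are jointly measurable in $(y,\gamma)$, let $\nu$ be a probability measure on $\mathcal X$, and let $(\pi_\gamma)_{\gamma\in\mathcal I}$ be probability measures on $\mathcal Y$ with $\pi_\gamma(B\times\Phi)=\nu(B)$ for all measurable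 $B\subseteq\mathcal X$ and all $\gamma$. Assume: (i) (contraction) each $\pi_\gamma$ is invariant for $P_\gamma$, and there are $M\in[1,\infty)$, $\tau\in[0,1)$ and an integer $k_0\ge1$ such that $\tau(P_\gamma)\le M$ and $\tau(P_\gamma^{k_0})\le\tau$ for all $\gamma\in\mathcal I$; (ii) (bounded eccentricity) there is $K\in(0,\infty)$ with $E_\gamma(y)=\int_{\mathcal Y} d(y,y')\,\pi_\gamma(\mathrm dy')\le K$ for all $\gamma\in\mathcal I$ and $y\in\mathcal Y$. Let $\beta\in(0,1)$, $k_j=\lceil j^\beta\rceil$ and $T_m=\sum_{j=1}^m k_j$ (so $T_0=0$). Let $(Y_n,\Gamma_n)_{n\ge0}$, with $Y_n=(X_n,\phi_n)$, be an AIR MCMC chain with values in $\mathcal Y\times\mathcal I$ on a probability space: $(Y_0,\Gamma_0)=(y_0,\gamma_0)$ is deterministic; with $\mathcal F_n=\sigma(Y_0,\dots,Y_n,\Gamma_0,\dots,\Gamma_n)$ one has $\mathbb P[Y_{n+1}\in B\mid\mathcal F_n]=P_{\Gamma_n}(Y_n,B)$ almost surely for all $n\ge 0$ and all measurable $B\subseteq\mathcal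 Y$; $\Gamma_n=U_n(Y_0,\dots,Y_n,\Gamma_0,\dots,\Gamma_{n-1})$ for measurable maps $U_n$; and $\Gamma_{i_1}=\Gamma_{i_2}$ whenever $i_1,i_2\in\{T_j,\dots,T_{j+1}-1\}$ for some $j\ge 0$. Theorem. Let $f\colon\mathcal X\to\mathbb R$ be measurable and such that $h(x,\phi)=f(x)$, $(x,\phi)\in\mathcal Y$, is bounded and satisfies $|h(y)-h(y')|\le L\,d(y,y')$ for all $y,y'\in\mathcal Y$, for some $L\in(0,\infty)$. Then for every $\varepsilon>\frac1{1+\beta}-\frac12$, $$\lim_{n\to\infty}\frac1{n^{1/2+\varepsilon}}\sum_{j=1}^n\bigl(f(X_j)-\nu(f)\bigr)=0\qquad\text{almost surely.}$$ -/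

import Mathlib

open MeasureTheory ProbabilityTheory Filter Topology
open scoped NNReal ENNReal

namespace AIRMCMC

section Wasserstein

variable {E : Type*}

/-- A distance-like function: a symmetric function with values in `[0, ∞)` that vanishes exactly
on the diagonal and is lower semicontinuous for the product topology. -/
structure IsDistanceLike [TopologicalSpace E] (d : E → E → ℝ≥0) : Prop where
  symm : ∀ x y, d x y = d y x
  eq_zero_iff : ∀ x y, d x y = 0 ↔ x = y
  lowerSemicontinuous : LowerSemicontinuous fun p : E × E => d p.1 p.2

/-- `ψ` is Lipschitz with constant `L` with respect to `d`. -/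
def IsLipschitzWrt (d : E → E → ℝ≥0) (L : ℝ) (ψ : E → ℝ) : Prop :=
  ∀ x y, |ψ x - ψ y| ≤ L * d x y

variable [MeasurableSpace E]

/-- The couplings of `μ₁` and `μ₂`: measures on the product with these two marginals. -/
def couplings (μ₁ μ₂ : Measure E) : Set (Measure (E × E)) :=
  {ξ | ξ.map Prod.fst = μ₁ ∧ ξ.map Prod.snd = μ₂}

/-- The Wasserstein-like function of `d`, with values in `[0, ∞]`. -/
noncomputable def wasserstein (d : E → E → ℝ≥0) (μ₁ μ₂ : Measure E) : ℝ≥0∞ :=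
  ⨅ ξ ∈ couplings μ₁ μ₂, ∫⁻ p, (d p.1 p.2 : ℝ≥0∞) ∂ξ

/-- The Wasserstein contraction coefficient `τ(P)` of a kernel, with values in `[0, ∞]`. -/
noncomputable def contractionCoeff (d : E → E → ℝ≥0) (P : Kernel E E) : ℝ≥0∞ :=
  ⨆ (y₁ : E) (y₂ : E) (_ : y₁ ≠ y₂), wasserstein d (P y₁) (P y₂) / (d y₁ y₂ : ℝ≥0∞)

/-- The eccentricity at `y` of the distribution `π`, with values in `[0, ∞]`. -/
noncomputable def eccentricity (d : E → E → ℝ≥0) (π : Measure E) (y : E) : ℝ≥0∞ :=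
  ∫⁻ y', (d y y' : ℝ≥0∞) ∂π

variable {I : Type*} [MeasurableSpace I]

/-- The main contraction assumption. The kernel `P_γ` of the family is `κ.sectL γ`, that is
`P_γ(y, B) = κ (y, γ) B`, and `P_γ ^ k₀` is its `k₀`-fold composition. -/
def ContractionAssumption (d : E → E → ℝ≥0) (κ : Kernel (E × I) E) (π : I → Measure E) : Prop :=
  (∀ γ, Kernel.Invariant (κ.sectL γ) (π γ)) ∧
  ∃ (M τ : ℝ≥0) (k₀ : ℕ), 1 ≤ M ∧ τ < 1 ∧ 1 ≤ k₀ ∧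
    ∀ γ, contractionCoeff d (κ.sectL γ) ≤ M ∧ contractionCoeff d (κ.sectL γ ^ k₀) ≤ τ

/-- The eccentricities are bounded, uniformly in the parameter and in the point. -/
def BoundedEccentricity (d : E → E → ℝ≥0) (π : I → Measure E) : Prop :=
  ∃ K : ℝ≥0, 0 < K ∧ ∀ γ y, eccentricity d (π γ) y ≤ K

end Wasserstein

section Chain

/-- The window lengths `k_j = ⌈j ^ β⌉`. -/
noncomputable def window (β : ℝ) (j : ℕ) : ℕ := ⌈(j : ℝ) ^ β⌉₊

/-- The adaptation times `T_m = k_1 + ⋯ + k_m`, with `T_0 = 0`. -/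
noncomputable def adaptTime (β : ℝ) (m : ℕ) : ℕ := ∑ j ∈ Finset.Icc 1 m, window β j

variable {Ω E I : Type*} [MeasurableSpace Ω] [mE : MeasurableSpace E] [mI : MeasurableSpace I]

/-- The history `σ(Y_0, …, Y_n, Γ_0, …, Γ_n)`. -/
abbrev history (Y : ℕ → Ω → E) (Γ : ℕ → Ω → I) (n : ℕ) : MeasurableSpace Ω :=
  ⨆ (j : ℕ) (_ : j ≤ n), mE.comap (Y j) ⊔ mI.comap (Γ j)

/-- `(Y_n, Γ_n)` is an AIR (adapted increasingly rarely) MCMC chain with kernels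
`P_γ(y, B) = κ (y, γ) B`, exponent `β` and initial values `y₀`, `γ₀`. -/
structure IsAIRChain (Pr : Measure Ω) (κ : Kernel (E × I) E) (β : ℝ) (y₀ : E) (γ₀ : I)
    (Y : ℕ → Ω → E) (Γ : ℕ → Ω → I) : Prop where
  measurable_state : ∀ n, Measurable (Y n)
  measurable_param : ∀ n, Measurable (Γ n)
  init_state : ∀ ω, Y 0 ω = y₀
  init_param : ∀ ω, Γ 0 ω = γ₀
  /-- Given the past, `Y_{n+1}` is drawn from `P_{Γ_n}(Y_n, ·)`. -/
  transition : ∀ (n : ℕ) (B : Set E), MeasurableSet B →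
    Pr[(Y (n + 1) ⁻¹' B).indicator (fun _ => (1 : ℝ)) | history Y Γ n]
      =ᵐ[Pr] fun ω => (κ (Y n ω, Γ n ω)).real B
  /-- `Γ_n = U_n(Y_0, …, Y_n, Γ_0, …, Γ_{n-1})` for measurable update rules `U_n`. -/
  update : ∃ U : (n : ℕ) → (Fin (n + 1) → E) × (Fin n → I) → I,
    (∀ n, Measurable (U n)) ∧
    ∀ n ω, Γ n ω = U n (fun i => Y i ω, fun i => Γ i ω)
  /-- The parameter changes only at the adaptation times. -/
  const_between : ∀ j i₁ i₂ : ℕ,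
    i₁ ∈ Set.Ico (adaptTime β j) (adaptTime β (j + 1)) →
    i₂ ∈ Set.Ico (adaptTime β j) (adaptTime β (j + 1)) → Γ i₁ = Γ i₂

end Chain

/-- The function `h = f · 1_Φ` on the augmented space, `h(x, φ) = f(x)`. -/
def augment {X : Type*} (Φ : Type*) (f : X → ℝ) : X × Φ → ℝ := fun y => f y.1

end AIRMCMC

/-!
Write `P_γ = κ (·, γ)`, `u = f - ν f` (a function of the first coordinate), and let `T` be the
operator `(T v) (y, γ) = ∫ v (y', γ) P_γ(y, dy')` (`transitionOp`).

*Poisson equation.* Integrating against a coupling shows that a kernel with contraction coefficient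
at most `t` multiplies Lipschitz constants with respect to `d` by at most `t`
(`isLipschitzWrt_integral_kernel`). Applied step by step to the functions `T^i u`, this gives
Lipschitz constants that decay geometrically in `i`, uniformly in `γ`; composing couplings, and with
it any measurable selection or triangle inequality, is never needed. As `T^i u (·, γ)` has integral
zero for the invariant law `π_γ`, bounded eccentricity turns the decay of Lipschitz constants into
decay of sup norms. Hence `g = ∑ T^i u` is bounded, jointly measurable, and solves `g - T g = u`
(`exists_poisson_solution`).

*Decomposition.* Along the chain,
`u (Y_i, Γ_i) = [g (Y_{i+1}, Γ_i) - T g (Y_i, Γ_i)] + [g (Y_i, Γ_i) - g (Y_{i+1}, Γ_i)]`.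
The first brackets are bounded martingale differences (`IsAIRChain.condExp_next`). By an
Azuma–Hoeffding bound and the Borel–Cantelli lemma their sums are `o(n ^ (1/2 + ε))` almost surely
for every `ε > 0` (`ae_tendsto_martingale_div_rpow`). The second brackets telescope except where the
parameter changes, which happens only at the adaptation times. Since `T_j ≥ (j / 2) ^ (1 + β)`,
there are at most `2 n ^ (1 / (1 + β))` of those up to time `n`, so these sums are
`O(n ^ (1 / (1 + β)))` (`abs_sum_sub_le`), and this is `o(n ^ (1/2 + ε))` because
`ε > 1 / (1 + β) - 1/2`.
-/

namespace AIRMCMC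

/-! ### A strong law for bounded martingale differences -/

section Martingale

/-- On `[-c, c]` the convex function `exp (t * ·)` lies below its chord. -/
lemma exp_mul_le_cosh_add {c x : ℝ} (hc : 0 < c) (hx : |x| ≤ c) (t : ℝ) :
    Real.exp (t * x) ≤ Real.cosh (t * c) + x * (Real.sinh (t * c) / c) := by
  have hx' := abs_le.mp hx
  have hconv : ConvexOn ℝ Set.univ Real.exp := convexOn_exp
  have ha : 0 ≤ (c + x) / (2 * c) := div_nonneg (by linarith) (by linarith)
  have hb : 0 ≤ (c - x) / (2 * c) := div_nonneg (by linarith) (by linarith)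
  have h := hconv.2 (Set.mem_univ (t * c)) (Set.mem_univ (-(t * c))) ha hb
    (by field_simp; ring)
  have e : ((c + x) / (2 * c)) • (t * c) + ((c - x) / (2 * c)) • (-(t * c)) = t * x := by
    simp only [smul_eq_mul]; field_simp; ring
  rw [e] at h
  refine h.trans (le_of_eq ?_)
  rw [Real.cosh_eq, Real.sinh_eq]
  simp only [smul_eq_mul]
  field_simp
  ring

variable {Ω : Type*} {m : MeasurableSpace Ω} {μ : Measure Ω}

/-- A bounded function that is measurable with respect to `m'` is uncorrelated with every
integrable function whose conditional expectation given `m'` vanishes. -/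
lemma integral_mul_eq_zero_of_condExp_eq_zero [IsFiniteMeasure μ] {m' : MeasurableSpace Ω}
    (hm : m' ≤ m) {Z ξ : Ω → ℝ} (hZ : StronglyMeasurable[m'] Z) {C : ℝ} (hC : ∀ ω, |Z ω| ≤ C)
    (hξ : Integrable ξ μ) (h0 : μ[ξ | m'] =ᵐ[μ] 0) : ∫ ω, Z ω * ξ ω ∂μ = 0 := by
  have hint : Integrable (Z * ξ) μ :=
    hξ.bdd_mul (hZ.mono hm).aestronglyMeasurable (ae_of_all _ fun ω => (hC ω))
  have h := condExp_mul_of_stronglyMeasurable_left (μ := μ) hZ hint hξ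
  have h2 := integral_condExp (μ := μ) (f := Z * ξ) hm
  have h3 : ∫ ω, (Z * ξ) ω ∂μ = 0 := by
    rw [← h2, integral_congr_ae (h.trans (EventuallyEq.rfl.mul h0))]
    simp
  exact h3

variable {𝓕 : ℕ → MeasurableSpace Ω} {ξ : ℕ → Ω → ℝ} {c : ℝ}

lemma abs_sum_range_le (hb : ∀ n ω, |ξ n ω| ≤ c) (n : ℕ) (ω : Ω) :
    |∑ i ∈ Finset.range n, ξ i ω| ≤ n * c := by
  refine (Finset.abs_sum_le_sum_abs _ _).trans ?_
  refine (Finset.sum_le_sum fun i _ => hb i ω).trans ?_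
  simp

lemma abs_exp_mul_sum_range_le (hb : ∀ n ω, |ξ n ω| ≤ c) (t : ℝ) (n : ℕ) (ω : Ω) :
    |Real.exp (t * ∑ i ∈ Finset.range n, ξ i ω)| ≤ Real.exp (|t| * (n * c)) := by
  rw [abs_of_pos (Real.exp_pos _), Real.exp_le_exp]
  refine (le_abs_self _).trans ?_
  rw [abs_mul]
  exact mul_le_mul_of_nonneg_left (abs_sum_range_le hb n ω) (abs_nonneg t)

lemma integrable_exp_mul_sum_range [IsFiniteMeasure μ] (hmeas : ∀ n, Measurable (ξ n))
    (hb : ∀ n ω, |ξ n ω| ≤ c) (t : ℝ) (n : ℕ) :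
    Integrable (fun ω => Real.exp (t * ∑ i ∈ Finset.range n, ξ i ω)) μ := by
  refine Integrable.of_bound (C := Real.exp (|t| * (n * c))) ?_
    (ae_of_all _ fun ω => abs_exp_mul_sum_range_le hb t n ω)
  exact (((Finset.measurable_sum _ fun i _ => hmeas i).const_mul t).exp).aestronglyMeasurable

/-- The Azuma–Hoeffding bound for the moment generating function of a sum of bounded martingale
differences. -/
lemma mgf_sum_range_le [IsProbabilityMeasure μ] (h𝓕 : ∀ n, 𝓕 n ≤ m)
    (hadapt : ∀ i n, i < n → Measurable[𝓕 n] (ξ i)) (hc : 0 < c) (hb : ∀ n ω, |ξ n ω| ≤ c)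
    (h0 : ∀ n, μ[ξ n | 𝓕 n] =ᵐ[μ] 0) (t : ℝ) (n : ℕ) :
    ∫ ω, Real.exp (t * ∑ i ∈ Finset.range n, ξ i ω) ∂μ ≤ Real.exp (n * ((t * c) ^ 2 / 2)) := by
  have hmeas : ∀ n, Measurable (ξ n) := fun n =>
    (hadapt n (n + 1) n.lt_succ_self).mono (h𝓕 _) le_rfl
  induction n with
  | zero => simp
  | succ n ih =>
    set Z : Ω → ℝ := fun ω => Real.exp (t * ∑ i ∈ Finset.range n, ξ i ω) with hZdef
    have hZi : Integrable Z μ := integrable_exp_mul_sum_range hmeas hb t n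
    have hZm : Measurable[𝓕 n] Z := by
      have : Measurable[𝓕 n] fun ω => ∑ i ∈ Finset.range n, ξ i ω :=
        Finset.measurable_sum _ fun i hi => hadapt i n (Finset.mem_range.mp hi)
      exact (this.const_mul t).exp
    have hξi : Integrable (ξ n) μ :=
      Integrable.of_bound (C := c) (hmeas n).aestronglyMeasurable (ae_of_all _ fun ω => hb n ω)
    have hZξ : Integrable (fun ω => Z ω * ξ n ω) μ :=
      hξi.bdd_mul hZi.aestronglyMeasurable
        (ae_of_all _ fun ω => abs_exp_mul_sum_range_le hb t n ω)
    have hzero : ∫ ω, Z ω * ξ n ω ∂μ = 0 :=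
      integral_mul_eq_zero_of_condExp_eq_zero (h𝓕 n) hZm.stronglyMeasurable
        (abs_exp_mul_sum_range_le hb t n) hξi (h0 n)
    calc ∫ ω, Real.exp (t * ∑ i ∈ Finset.range (n + 1), ξ i ω) ∂μ
        ≤ ∫ ω, (Real.cosh (t * c) * Z ω + Real.sinh (t * c) / c * (Z ω * ξ n ω)) ∂μ := by
          refine integral_mono (integrable_exp_mul_sum_range hmeas hb t (n + 1))
            ((hZi.const_mul _).add (hZξ.const_mul _)) fun ω => ?_
          have h1 : Real.exp (t * ∑ i ∈ Finset.range (n + 1), ξ i ω)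
              = Z ω * Real.exp (t * ξ n ω) := by
            rw [Finset.sum_range_succ, mul_add, Real.exp_add]
          have h2 := mul_le_mul_of_nonneg_left (exp_mul_le_cosh_add hc (hb n ω) t)
            (Real.exp_pos (t * ∑ i ∈ Finset.range n, ξ i ω)).le
          simp only [h1]
          refine h2.trans (le_of_eq ?_)
          simp only [hZdef]
          ring
      _ = Real.cosh (t * c) * ∫ ω, Z ω ∂μ := by
          rw [integral_add (hZi.const_mul _) (hZξ.const_mul _), integral_const_mul,
            integral_const_mul, hzero, mul_zero, add_zero]
      _ ≤ Real.exp ((t * c) ^ 2 / 2) * Real.exp (n * ((t * c) ^ 2 / 2)) :=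
          mul_le_mul (Real.cosh_le_exp_half_sq _) ih
            (integral_nonneg fun ω => (Real.exp_pos _).le) (Real.exp_pos _).le
      _ = Real.exp ((n + 1 : ℕ) * ((t * c) ^ 2 / 2)) := by
          rw [← Real.exp_add]; push_cast; ring_nf

/-- The Chernoff bound with parameter `n ^ (-1/2)`. -/
lemma measureReal_rpow_le_sum_range [IsProbabilityMeasure μ] (h𝓕 : ∀ n, 𝓕 n ≤ m)
    (hadapt : ∀ i n, i < n → Measurable[𝓕 n] (ξ i)) (hc : 0 < c) (hb : ∀ n ω, |ξ n ω| ≤ c)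
    (h0 : ∀ n, μ[ξ n | 𝓕 n] =ᵐ[μ] 0) (ε δ : ℝ) {n : ℕ} (hn : n ≠ 0) :
    μ.real {ω | δ * (n : ℝ) ^ (1 / 2 + ε) ≤ ∑ i ∈ Finset.range n, ξ i ω}
      ≤ Real.exp (c ^ 2 / 2) * Real.exp (-δ * (n : ℝ) ^ ε) := by
  have hmeas : ∀ n, Measurable (ξ n) := fun n =>
    (hadapt n (n + 1) n.lt_succ_self).mono (h𝓕 _) le_rfl
  have hn0 : (0 : ℝ) < n := by exact_mod_cast Nat.pos_of_ne_zero hn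
  set t : ℝ := (n : ℝ) ^ (-(1 / 2) : ℝ) with ht
  have ht0 : 0 ≤ t := Real.rpow_nonneg hn0.le _
  have h1 := measure_ge_le_exp_mul_mgf (μ := μ) (X := fun ω => ∑ i ∈ Finset.range n, ξ i ω)
    (δ * (n : ℝ) ^ (1 / 2 + ε)) ht0 (integrable_exp_mul_sum_range hmeas hb t n)
  have h2 := mgf_sum_range_le h𝓕 hadapt hc hb h0 t n
  have e1 : -t * (δ * (n : ℝ) ^ (1 / 2 + ε)) = -δ * (n : ℝ) ^ ε := by
    have : t * (n : ℝ) ^ (1 / 2 + ε) = (n : ℝ) ^ ε := by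
      rw [ht, ← Real.rpow_add hn0]; ring_nf
    linear_combination -δ * this
  have e2 : (n : ℝ) * ((t * c) ^ 2 / 2) = c ^ 2 / 2 := by
    have : t ^ 2 * n = 1 := by
      rw [ht, ← Real.rpow_natCast, ← Real.rpow_mul hn0.le]
      norm_num
      rw [Real.rpow_neg_one, inv_mul_cancel₀ hn0.ne']
    linear_combination c ^ 2 / 2 * this
  rw [e1] at h1
  rw [e2] at h2
  refine h1.trans ?_
  rw [mul_comm]
  exact mul_le_mul_of_nonneg_right h2 (Real.exp_pos _).le

lemma summable_exp_neg_mul_rpow {ε δ : ℝ} (hε : 0 < ε) (hδ : 0 < δ) :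
    Summable fun n : ℕ => Real.exp (-δ * (n : ℝ) ^ ε) := by
  have h1 : Tendsto (fun n : ℕ => (n : ℝ) ^ ε) atTop atTop :=
    (tendsto_rpow_atTop hε).comp tendsto_natCast_atTop_atTop
  have h2 := (isLittleO_exp_neg_mul_rpow_atTop hδ (-2 / ε)).comp_tendsto h1
  refine summable_of_isBigO_nat (g := fun n : ℕ => (n : ℝ) ^ (-2 : ℝ))
    (Real.summable_nat_rpow.mpr (by norm_num)) ?_
  refine h2.isBigO.congr_right fun n => ?_
  simp only [Function.comp]
  rw [← Real.rpow_mul n.cast_nonneg]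
  congr 1
  field_simp

lemma ae_eventually_sum_range_lt [IsProbabilityMeasure μ] (h𝓕 : ∀ n, 𝓕 n ≤ m)
    (hadapt : ∀ i n, i < n → Measurable[𝓕 n] (ξ i)) (hc : 0 < c) (hb : ∀ n ω, |ξ n ω| ≤ c)
    (h0 : ∀ n, μ[ξ n | 𝓕 n] =ᵐ[μ] 0) {ε δ : ℝ} (hε : 0 < ε) (hδ : 0 < δ) :
    ∀ᵐ ω ∂μ, ∀ᶠ n : ℕ in atTop,
      ∑ i ∈ Finset.range n, ξ i ω < δ * (n : ℝ) ^ (1 / 2 + ε) := by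
  -- The Chernoff bound needs a nonzero time, hence the shift by one.
  set s : ℕ → Set Ω := fun n => {ω | δ * ((n + 1 : ℕ) : ℝ) ^ (1 / 2 + ε)
    ≤ ∑ i ∈ Finset.range (n + 1), ξ i ω} with hs
  have hsum : Summable fun n => μ.real (s n) := by
    refine Summable.of_nonneg_of_le (fun n => measureReal_nonneg)
      (fun n => measureReal_rpow_le_sum_range h𝓕 hadapt hc hb h0 ε δ n.succ_ne_zero) ?_
    exact ((summable_nat_add_iff 1).mpr (summable_exp_neg_mul_rpow hε hδ)).mul_left _
  have hfin : ∑' n, μ (s n) ≠ ∞ := by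
    have : ∀ n, μ (s n) = ENNReal.ofReal (μ.real (s n)) := fun n => by simp
    simp_rw [this]
    exact hsum.tsum_ofReal_ne_top
  filter_upwards [ae_eventually_notMem hfin] with ω hω
  refine (eventually_map (m := fun n : ℕ => n + 1)).mpr ?_ |>.filter_mono
    (map_add_atTop_eq_nat 1).ge
  filter_upwards [hω] with n hn
  simpa only [hs, Set.mem_ofPred_eq, not_le] using hn

/-- Partial sums of uniformly bounded martingale differences are `o(n ^ (1/2 + ε))` almost
surely. -/
theorem ae_tendsto_martingale_div_rpow [IsProbabilityMeasure μ] (h𝓕 : ∀ n, 𝓕 n ≤ m)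
    (hadapt : ∀ i n, i < n → Measurable[𝓕 n] (ξ i)) (hb : ∀ n ω, |ξ n ω| ≤ c)
    (h0 : ∀ n, μ[ξ n | 𝓕 n] =ᵐ[μ] 0) {ε : ℝ} (hε : 0 < ε) :
    ∀ᵐ ω ∂μ, Tendsto
      (fun n : ℕ => 1 / (n : ℝ) ^ (1 / 2 + ε) * ∑ i ∈ Finset.range n, ξ i ω) atTop (𝓝 0) := by
  -- `c = 0` is allowed here, while the chord bound needs a positive constant.
  have hc : 0 < |c| + 1 := by positivity
  have hb' : ∀ n ω, |ξ n ω| ≤ |c| + 1 := fun n ω => by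
    linarith [hb n ω, le_abs_self c]
  have hup : ∀ k : ℕ, ∀ᵐ ω ∂μ, ∀ᶠ n : ℕ in atTop,
      ∑ i ∈ Finset.range n, ξ i ω < (1 / ((k : ℝ) + 1)) * (n : ℝ) ^ (1 / 2 + ε) := fun k =>
    ae_eventually_sum_range_lt h𝓕 hadapt hc hb' h0 hε (by positivity)
  have hlow : ∀ k : ℕ, ∀ᵐ ω ∂μ, ∀ᶠ n : ℕ in atTop,
      ∑ i ∈ Finset.range n, (-ξ i) ω < (1 / ((k : ℝ) + 1)) * (n : ℝ) ^ (1 / 2 + ε) := fun k =>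
    ae_eventually_sum_range_lt h𝓕 (fun i n hi => (hadapt i n hi).neg) hc
      (fun n ω => by simpa using hb' n ω)
      (fun n => by
        filter_upwards [condExp_neg (μ := μ) (ξ n) (𝓕 n), h0 n] with ω h1 h2
        rw [h1, Pi.neg_apply, h2]; simp)
      hε (by positivity)
  filter_upwards [ae_all_iff.mpr hup, ae_all_iff.mpr hlow] with ω h1 h2
  rw [Metric.tendsto_nhds]
  intro δ hδ
  obtain ⟨k, hk⟩ := exists_nat_one_div_lt hδ
  filter_upwards [h1 k, h2 k, eventually_gt_atTop 0] with n hn1 hn2 hn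
  have hpos : (0 : ℝ) < (n : ℝ) ^ (1 / 2 + ε) := Real.rpow_pos_of_pos (by exact_mod_cast hn) _
  have habs : |∑ i ∈ Finset.range n, ξ i ω| < (1 / ((k : ℝ) + 1)) * (n : ℝ) ^ (1 / 2 + ε) := by
    simp only [Pi.neg_apply, Finset.sum_neg_distrib] at hn2
    exact abs_lt.mpr ⟨by linarith, hn1⟩
  rw [Real.dist_eq, sub_zero, abs_mul, abs_of_pos (by positivity : 0 < 1 / (n : ℝ) ^ (1 / 2 + ε)),
    one_div, inv_mul_lt_iff₀ hpos]
  nlinarith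

end Martingale

/-! ### Contraction of Lipschitz functions -/

section Contraction

variable {E : Type*} [MeasurableSpace E]

lemma integrable_of_measurable_of_abs_le {μ : Measure E} [IsFiniteMeasure μ] {u : E → ℝ}
    (hu : Measurable u) {C : ℝ} (hC : ∀ y, |u y| ≤ C) : Integrable u μ :=
  Integrable.of_bound (C := C) hu.aestronglyMeasurable (ae_of_all μ fun y => (hC y : ‖u y‖ ≤ C))

lemma abs_integral_le_of_abs_le {μ : Measure E} [IsProbabilityMeasure μ] {u : E → ℝ} {C : ℝ}
    (hC : ∀ y, |u y| ≤ C) : |∫ y, u y ∂μ| ≤ C := by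
  simpa using norm_integral_le_of_norm_le_const (μ := μ) (f := u) (ae_of_all μ hC)

/-- The easy half of Kantorovich duality. Integrating against a coupling needs no optimal
coupling and no triangle inequality for `d`. -/
lemma enorm_integral_sub_le_wasserstein {d : E → E → ℝ≥0} {l : ℝ≥0} {u : E → ℝ}
    (hu : Measurable u) {C : ℝ} (hC : ∀ y, |u y| ≤ C) (hLip : IsLipschitzWrt d l u)
    {μ₁ μ₂ : Measure E} [IsProbabilityMeasure μ₁] [IsProbabilityMeasure μ₂] :
    ‖∫ y, u y ∂μ₁ - ∫ y, u y ∂μ₂‖ₑ ≤ l * wasserstein d μ₁ μ₂ := by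
  have key : ∀ ξ ∈ couplings μ₁ μ₂, ‖∫ y, u y ∂μ₁ - ∫ y, u y ∂μ₂‖ₑ
      ≤ l * ∫⁻ p, (d p.1 p.2 : ℝ≥0∞) ∂ξ := by
    rintro ξ ⟨h1, h2⟩
    have i1 : Integrable (fun p : E × E => u p.1) ξ := by
      refine Integrable.comp_measurable (g := u) ?_ measurable_fst
      rw [h1]; exact integrable_of_measurable_of_abs_le hu hC
    have i2 : Integrable (fun p : E × E => u p.2) ξ := by
      refine Integrable.comp_measurable (g := u) ?_ measurable_snd
      rw [h2]; exact integrable_of_measurable_of_abs_le hu hC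
    have e1 : ∫ y, u y ∂μ₁ = ∫ p, u p.1 ∂ξ := by
      rw [← h1, integral_map measurable_fst.aemeasurable hu.aestronglyMeasurable]
    have e2 : ∫ y, u y ∂μ₂ = ∫ p, u p.2 ∂ξ := by
      rw [← h2, integral_map measurable_snd.aemeasurable hu.aestronglyMeasurable]
    rw [e1, e2, ← integral_sub i1 i2, ← lintegral_const_mul' _ _ ENNReal.coe_ne_top]
    refine (enorm_integral_le_lintegral_enorm _).trans (lintegral_mono fun p => ?_)
    have h := hLip p.1 p.2
    rw [← ENNReal.coe_mul, enorm_eq_nnnorm, ENNReal.coe_le_coe, ← NNReal.coe_le_coe]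
    simpa using h
  rw [wasserstein]
  rcases eq_or_ne l 0 with rfl | hl
  -- A zero factor cannot be moved inside the infima, the inner one of which is `∞` off the
  -- couplings; the product coupling settles this case.
  · have hprod : μ₁.prod μ₂ ∈ couplings μ₁ μ₂ :=
      ⟨by simp [Measure.map_fst_prod], by simp [Measure.map_snd_prod]⟩
    simpa using key _ hprod
  · rw [ENNReal.mul_iInf_of_ne (by simpa using hl) ENNReal.coe_ne_top]
    refine le_iInf fun ξ => ?_
    rw [ENNReal.mul_iInf_of_ne (by simpa using hl) ENNReal.coe_ne_top]
    exact le_iInf fun hξ => key ξ hξ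

/-- A kernel multiplies the Lipschitz constants of bounded functions by at most its contraction
coefficient. -/
lemma isLipschitzWrt_integral_kernel {d : E → E → ℝ≥0} (hd : ∀ x y, d x y = 0 → x = y)
    {P : Kernel E E} [IsMarkovKernel P] {t : ℝ≥0} (hP : contractionCoeff d P ≤ t)
    {l : ℝ≥0} {u : E → ℝ} (hu : Measurable u) {C : ℝ} (hC : ∀ y, |u y| ≤ C)
    (hLip : IsLipschitzWrt d l u) : IsLipschitzWrt d (t * l : ℝ≥0) fun y => ∫ y', u y' ∂P y := by
  intro x y
  rcases eq_or_ne x y with rfl | hxy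
  · simp only [sub_self, abs_zero]; positivity
  have hW : wasserstein d (P x) (P y) ≤ t * d x y := by
    have h1 : wasserstein d (P x) (P y) / d x y ≤ t :=
      le_trans (le_iSup₂_of_le x y
        (le_iSup (fun _ : x ≠ y => wasserstein d (P x) (P y) / d x y) hxy)) hP
    refine (ENNReal.div_le_iff ?_ ENNReal.coe_ne_top).mp h1
    simpa using fun h => hxy (hd x y h)
  have h := (enorm_integral_sub_le_wasserstein hu hC hLip).trans (mul_le_mul_right hW (l : ℝ≥0∞))
  rw [enorm_eq_nnnorm, ← ENNReal.coe_mul, ← ENNReal.coe_mul, ENNReal.coe_le_coe,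
    ← NNReal.coe_le_coe] at h
  refine h.trans (le_of_eq ?_)
  push_cast
  ring

/-- A Lipschitz function of mean zero is bounded in terms of the eccentricity, because it is its
own difference from its mean. -/
lemma abs_le_of_isLipschitzWrt_of_integral_eq_zero {d : E → E → ℝ≥0} {l K : ℝ≥0} {u : E → ℝ}
    (hu : Measurable u) {C : ℝ} (hC : ∀ y, |u y| ≤ C) (hLip : IsLipschitzWrt d l u)
    {ϖ : Measure E} [IsProbabilityMeasure ϖ] (h0 : ∫ y, u y ∂ϖ = 0) {y : E}
    (hK : eccentricity d ϖ y ≤ K) : |u y| ≤ l * K := by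
  have e : u y = ∫ y', (u y - u y') ∂ϖ := by
    rw [integral_sub (integrable_const _) (integrable_of_measurable_of_abs_le hu hC), h0]
    simp
  have h : ‖u y‖ₑ ≤ l * K := by
    calc ‖u y‖ₑ = ‖∫ y', (u y - u y') ∂ϖ‖ₑ := by rw [← e]
      _ ≤ ∫⁻ y', ‖u y - u y'‖ₑ ∂ϖ := enorm_integral_le_lintegral_enorm _
      _ ≤ ∫⁻ y', l * d y y' ∂ϖ := by
        refine lintegral_mono fun y' => ?_
        rw [← ENNReal.coe_mul, enorm_eq_nnnorm, ENNReal.coe_le_coe, ← NNReal.coe_le_coe]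
        simpa using hLip y y'
      _ = l * eccentricity d ϖ y := lintegral_const_mul' _ _ ENNReal.coe_ne_top
      _ ≤ l * K := by gcongr
  rw [enorm_eq_nnnorm, ← ENNReal.coe_mul, ENNReal.coe_le_coe, ← NNReal.coe_le_coe] at h
  simpa using h

variable {I : Type*} [MeasurableSpace I]

/-- The transition operator `(y, γ) ↦ ∫ u (y', γ) P_γ(y, dy')` of the family
`P_γ(y, ·) = κ (y, γ)`, acting on functions of the state and the parameter. -/
noncomputable def transitionOp (κ : Kernel (E × I) E) (u : E × I → ℝ) : E × I → ℝ :=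
  fun p => ∫ y', u (y', p.2) ∂κ p

variable {κ : Kernel (E × I) E}

lemma measurable_transitionOp [IsSFiniteKernel κ] {u : E × I → ℝ} (hu : Measurable u) :
    Measurable (transitionOp κ u) := by
  refine (StronglyMeasurable.integral_kernel_prod_right (κ := κ)
    (f := fun p y' => u (y', p.2)) ?_).measurable
  exact (hu.comp (by fun_prop : Measurable fun q : (E × I) × E => (q.2, q.1.2))).stronglyMeasurable

lemma measurable_transitionOp_iterate [IsSFiniteKernel κ] {u : E × I → ℝ} (hu : Measurable u)
    (n : ℕ) : Measurable ((transitionOp κ)^[n] u) := by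
  induction n with
  | zero => simpa using hu
  | succ n ih => rw [Function.iterate_succ_apply']; exact measurable_transitionOp ih

lemma abs_transitionOp_le [IsMarkovKernel κ] {u : E × I → ℝ} {C : ℝ} (hC : ∀ p, |u p| ≤ C)
    (p : E × I) : |transitionOp κ u p| ≤ C :=
  abs_integral_le_of_abs_le fun y => hC (y, p.2)

lemma abs_transitionOp_iterate_le [IsMarkovKernel κ] {u : E × I → ℝ} {C : ℝ}
    (hC : ∀ p, |u p| ≤ C) (n : ℕ) (p : E × I) : |(transitionOp κ)^[n] u p| ≤ C := by
  induction n generalizing p with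
  | zero => simpa using hC p
  | succ n ih => rw [Function.iterate_succ_apply']; exact abs_transitionOp_le ih p

instance isMarkovKernel_pow {P : Kernel E E} [IsMarkovKernel P] (n : ℕ) :
    IsMarkovKernel (P ^ n) := by
  induction n with
  | zero => rw [pow_zero]; exact inferInstanceAs (IsMarkovKernel Kernel.id)
  | succ n ih => rw [Kernel.pow_add, pow_one]; infer_instance

/-- With the parameter frozen, the iterates of the transition operator integrate against the powers
of the corresponding kernel. -/
lemma transitionOp_iterate_apply [IsMarkovKernel κ] {u : E × I → ℝ} (hu : Measurable u) {C : ℝ}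
    (hC : ∀ p, |u p| ≤ C) (n : ℕ) (y : E) (γ : I) :
    (transitionOp κ)^[n] u (y, γ) = ∫ y', u (y', γ) ∂(κ.sectL γ ^ n) y := by
  have hsec : ∀ {v : E × I → ℝ}, Measurable v → Measurable fun y => v (y, γ) := fun hv =>
    hv.comp (by fun_prop)
  induction n generalizing u with
  | zero =>
    have : (κ.sectL γ ^ 0) y = Measure.dirac y := by
      rw [pow_zero]; exact Kernel.id_apply y
    rw [this, integral_dirac' _ _ (hsec hu).stronglyMeasurable]
    rfl
  | succ n ih =>
    rw [Function.iterate_succ_apply, ih (measurable_transitionOp hu) (abs_transitionOp_le hC),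
      add_comm n 1, Kernel.pow_add, Kernel.integral_comp, pow_one]
    · rfl
    · exact integrable_of_measurable_of_abs_le (hsec hu) fun y => hC (y, γ)

lemma isLipschitzWrt_transitionOp_iterate_add [IsMarkovKernel κ] {d : E → E → ℝ≥0}
    (hd : ∀ x y, d x y = 0 → x = y) {u : E × I → ℝ} (hu : Measurable u) {C : ℝ}
    (hC : ∀ p, |u p| ≤ C) {γ : I} {t l : ℝ≥0} {k i : ℕ}
    (hk : contractionCoeff d (κ.sectL γ ^ k) ≤ t)
    (hLip : IsLipschitzWrt d l fun y => (transitionOp κ)^[i] u (y, γ)) :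
    IsLipschitzWrt d (t * l : ℝ≥0) fun y => (transitionOp κ)^[i + k] u (y, γ) := by
  have hm := measurable_transitionOp_iterate (κ := κ) hu i
  have hb := abs_transitionOp_iterate_le (κ := κ) hC i
  have h := isLipschitzWrt_integral_kernel hd hk (hm.comp measurable_prodMk_right)
    (fun y => hb (y, γ)) hLip
  have e : ∀ y, (transitionOp κ)^[i + k] u (y, γ)
      = ∫ y', (transitionOp κ)^[i] u (y', γ) ∂(κ.sectL γ ^ k) y := fun y => by
    rw [add_comm, Function.iterate_add_apply, transitionOp_iterate_apply hm hb]
  simp only [e]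
  exact h

lemma IsLipschitzWrt.mono {E : Type*} {d : E → E → ℝ≥0} {l l' : ℝ} {u : E → ℝ}
    (h : IsLipschitzWrt d l u) (hl : l ≤ l') : IsLipschitzWrt d l' u := fun x y =>
  (h x y).trans (mul_le_mul_of_nonneg_right hl (d x y).coe_nonneg)

/-- If every kernel is Lipschitz with constant `M` and its `k₀`-th power contracts by `τ < 1`, the
Lipschitz constants of the iterates decay geometrically, uniformly in the parameter. -/
lemma exists_isLipschitzWrt_transitionOp_iterate [IsMarkovKernel κ] {d : E → E → ℝ≥0}
    (hd : ∀ x y, d x y = 0 → x = y) {M τ : ℝ≥0} {k₀ : ℕ} (hM : 1 ≤ M) (hτ : τ < 1) (hk₀ : 1 ≤ k₀)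
    (hc : ∀ γ, contractionCoeff d (κ.sectL γ) ≤ M ∧ contractionCoeff d (κ.sectL γ ^ k₀) ≤ τ)
    {u : E × I → ℝ} (hu : Measurable u) {C : ℝ} (hC : ∀ p, |u p| ≤ C) {l : ℝ≥0}
    (hLip : ∀ γ, IsLipschitzWrt d l fun y => u (y, γ)) :
    ∃ A ρ : ℝ≥0, ρ < 1 ∧
      ∀ i γ, IsLipschitzWrt d (A * ρ ^ i : ℝ≥0) fun y => (transitionOp κ)^[i] u (y, γ) := by
  -- `τ` may vanish; a positive rate `ρ` with `τ ≤ ρ ^ k₀` is needed to absorb the first `k₀` steps.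
  set t : ℝ≥0 := max τ (1 / 2) with ht
  have ht0 : 0 < t := lt_of_lt_of_le (by norm_num) (le_max_right _ _)
  have ht1 : t < 1 := max_lt hτ (by rw [div_lt_one] <;> norm_num)
  set ρ : ℝ≥0 := t ^ (1 / (k₀ : ℝ)) with hρ
  have hk : (k₀ : ℝ) ≠ 0 := by positivity
  have hρk : ρ ^ k₀ = t := by
    rw [hρ, ← NNReal.rpow_natCast, ← NNReal.rpow_mul, one_div, inv_mul_cancel₀ hk, NNReal.rpow_one]
  have hρ0 : 0 < ρ := NNReal.rpow_pos ht0
  have hρ1 : ρ < 1 := NNReal.rpow_lt_one ht1 (by positivity)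
  have hpow : ∀ i γ, IsLipschitzWrt d (M ^ i * l : ℝ≥0)
      fun y => (transitionOp κ)^[i] u (y, γ) := by
    intro i γ
    induction i with
    | zero => simpa using hLip γ
    | succ i ih =>
      have := isLipschitzWrt_transitionOp_iterate_add (k := 1) hd hu hC
        (by simpa using (hc γ).1) ih
      rwa [← mul_assoc, ← pow_succ'] at this
  refine ⟨M ^ k₀ * l / ρ ^ k₀, ρ, hρ1, fun i γ => ?_⟩
  induction i using Nat.strong_induction_on with
  | _ i ih =>
    rcases lt_or_ge i k₀ with hi | hi
    · refine (hpow i γ).mono (NNReal.coe_le_coe.mpr ?_)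
      rw [div_mul_eq_mul_div, le_div_iff₀ (pow_pos hρ0 _)]
      exact mul_le_mul (mul_le_mul_left (pow_le_pow_right₀ hM hi.le) l)
        (pow_le_pow_of_le_one hρ0.le hρ1.le hi.le) (by positivity) (by positivity)
    · obtain ⟨j, rfl⟩ := Nat.exists_eq_add_of_le' hi
      refine (isLipschitzWrt_transitionOp_iterate_add hd hu hC (hc γ).2
        (ih j (by omega))).mono (NNReal.coe_le_coe.mpr ?_)
      rw [pow_add, hρk]
      calc τ * (M ^ k₀ * l / t * ρ ^ j) ≤ t * (M ^ k₀ * l / t * ρ ^ j) := by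
            gcongr; exact le_max_left _ _
        _ = M ^ k₀ * l / t * (ρ ^ j * t) := by ring

lemma integral_transitionOp_iterate [IsMarkovKernel κ] {ϖ : Measure E} [IsProbabilityMeasure ϖ]
    {γ : I} (hinv : Kernel.Invariant (κ.sectL γ) ϖ) {u : E × I → ℝ} (hu : Measurable u) {C : ℝ}
    (hC : ∀ p, |u p| ≤ C) (n : ℕ) :
    ∫ y, (transitionOp κ)^[n] u (y, γ) ∂ϖ = ∫ y, u (y, γ) ∂ϖ := by
  induction n with
  | zero => rfl
  | succ n ih =>
    have hm := measurable_transitionOp_iterate (κ := κ) hu n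
    have hb := abs_transitionOp_iterate_le (κ := κ) hC n
    have hcomp : (κ.sectL γ ∘ₖ Kernel.const Unit ϖ) () = ϖ := by
      rw [Kernel.comp_apply, Kernel.const_apply, hinv.def]
    have hint : Integrable (fun y => (transitionOp κ)^[n] u (y, γ))
        ((κ.sectL γ ∘ₖ Kernel.const Unit ϖ) ()) :=
      integrable_of_measurable_of_abs_le (hm.comp measurable_prodMk_right) fun y => hb (y, γ)
    have h := Kernel.integral_comp hint
    rw [hcomp, ih, Kernel.const_apply] at h
    rw [h]
    simp only [Function.iterate_succ_apply']
    rfl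

/-- A bounded measurable solution `g` of the Poisson equations `g_γ - P_γ g_γ = u_γ`, uniformly in
the parameter: the sum of the iterates of the transition operator. -/
theorem exists_poisson_solution [IsMarkovKernel κ] {d : E → E → ℝ≥0}
    (hd : ∀ x y, d x y = 0 → x = y) {ϖ : I → Measure E} [∀ γ, IsProbabilityMeasure (ϖ γ)]
    (hcontr : ContractionAssumption d κ ϖ) (hecc : BoundedEccentricity d ϖ)
    {u : E × I → ℝ} (hu : Measurable u) {C : ℝ} (hC : ∀ p, |u p| ≤ C) {l : ℝ≥0}
    (hLip : ∀ γ, IsLipschitzWrt d l fun y => u (y, γ)) (h0 : ∀ γ, ∫ y, u (y, γ) ∂ϖ γ = 0) :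
    ∃ g : E × I → ℝ, Measurable g ∧ (∃ G, ∀ p, |g p| ≤ G) ∧
      ∀ p, g p - transitionOp κ g p = u p := by
  obtain ⟨hinv, M, τ, k₀, hM, hτ, hk₀, hc⟩ := hcontr
  obtain ⟨K, -, hK⟩ := hecc
  obtain ⟨A, ρ, hρ, hA⟩ :=
    exists_isLipschitzWrt_transitionOp_iterate hd hM hτ hk₀ hc hu hC hLip
  set v : ℕ → E × I → ℝ := fun i => (transitionOp κ)^[i] u with hv
  have hvm : ∀ i, Measurable (v i) := measurable_transitionOp_iterate hu
  set b : ℕ → ℝ := fun i => A * ρ ^ i * K with hb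
  have hvb : ∀ i p, |v i p| ≤ b i := by
    rintro i ⟨y, γ⟩
    have := abs_le_of_isLipschitzWrt_of_integral_eq_zero
      (u := fun y => v i (y, γ)) ((hvm i).comp measurable_prodMk_right)
      (fun y => abs_transitionOp_iterate_le hC i (y, γ)) (hA i γ)
      ((integral_transitionOp_iterate (hinv γ) hu hC i).trans (h0 γ)) (hK γ y)
    simpa [hb] using this
  have hbs : Summable b :=
    ((summable_geometric_of_lt_one ρ.coe_nonneg (by exact_mod_cast hρ)).mul_left _).mul_right _
  have hvs : ∀ p, Summable fun i => v i p := fun p =>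
    Summable.of_norm_bounded (f := fun i => v i p) hbs fun i => hvb i p
  refine ⟨fun p => ∑' i, v i p, ?_, ⟨∑' i, b i, fun p => ?_⟩, fun p => ?_⟩
  · refine measurable_of_tendsto_metrizable
      (fun n => Finset.measurable_sum (Finset.range n) fun i _ => hvm i) ?_
    rw [tendsto_pi_nhds]
    intro p
    simpa using (hvs p).hasSum.tendsto_sum_nat
  · exact tsum_of_norm_bounded (f := fun i => v i p) hbs.hasSum fun i => hvb i p
  · have hint : ∀ i, Integrable (fun y => v i (y, p.2)) (κ p) := fun i =>
      integrable_of_measurable_of_abs_le ((hvm i).comp measurable_prodMk_right)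
        fun y => hvb i (y, p.2)
    have hsum := hasSum_integral_of_summable_integral_norm hint (by
      refine Summable.of_nonneg_of_le (fun i => integral_nonneg fun y => norm_nonneg _)
        (fun i => ?_) hbs
      refine (le_abs_self _).trans (abs_integral_le_of_abs_le fun y => ?_)
      rw [abs_of_nonneg (norm_nonneg _)]
      exact hvb i (y, p.2))
    have hT : transitionOp κ (fun p => ∑' i, v i p) p = ∑' i, v (i + 1) p := by
      refine hsum.tsum_eq.symm.trans (tsum_congr fun i => ?_)
      simp only [hv, Function.iterate_succ_apply']
      rfl
    rw [hT]
    simp only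
    rw [(hvs p).tsum_eq_zero_add]
    simp [hv]

end Contraction

/-! ### Growth of the adaptation times -/

section AdaptTime

variable {β : ℝ}

lemma adaptTime_zero : adaptTime β 0 = 0 := by simp [adaptTime]

lemma adaptTime_succ (m : ℕ) : adaptTime β (m + 1) = adaptTime β m + window β (m + 1) :=
  Finset.sum_Icc_succ_top (by omega) _

lemma one_le_window {j : ℕ} (hj : 1 ≤ j) : 1 ≤ window β j :=
  Nat.ceil_pos.mpr (Real.rpow_pos_of_pos (by exact_mod_cast hj) _)

lemma le_adaptTime (m : ℕ) : m ≤ adaptTime β m := by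
  induction m with
  | zero => exact Nat.zero_le _
  | succ m ih =>
    rw [adaptTime_succ]
    exact Nat.add_le_add ih (one_le_window (by omega))

lemma exists_adaptTime_le_lt (i : ℕ) : ∃ j, adaptTime β j ≤ i ∧ i < adaptTime β (j + 1) := by
  have hex : ∃ m, i < adaptTime β m := ⟨i + 1, le_adaptTime (i + 1)⟩
  obtain ⟨j, hj⟩ := Nat.exists_eq_succ_of_ne_zero (n := Nat.find hex) fun h => by
    have := Nat.find_spec hex
    rw [h, adaptTime_zero] at this
    omega
  refine ⟨j, not_lt.mp (Nat.find_min hex (by omega)), ?_⟩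
  have := Nat.find_spec hex
  rwa [hj] at this

/-- Only the last half of the windows is needed for this lower bound. -/
lemma half_rpow_le_adaptTime (hβ : 0 < β) (j : ℕ) :
    ((j : ℝ) / 2) ^ (1 + β) ≤ adaptTime β j := by
  rcases Nat.eq_zero_or_pos j with rfl | hj
  · simp [Real.zero_rpow (by linarith : 1 + β ≠ 0)]
  have hj2 : (0 : ℝ) < j / 2 := by positivity
  have hcard : (j : ℝ) / 2 ≤ (Finset.Icc ((j + 1) / 2) j).card := by
    rw [Nat.card_Icc, div_le_iff₀ two_pos]
    exact_mod_cast (by omega : j ≤ (j + 1 - (j + 1) / 2) * 2)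
  calc ((j : ℝ) / 2) ^ (1 + β) = (j : ℝ) / 2 * ((j : ℝ) / 2) ^ β := by
        rw [Real.rpow_add hj2, Real.rpow_one]
    _ ≤ (Finset.Icc ((j + 1) / 2) j).card * ((j : ℝ) / 2) ^ β := by gcongr
    _ = ∑ i ∈ Finset.Icc ((j + 1) / 2) j, ((j : ℝ) / 2) ^ β := by simp
    _ ≤ ∑ i ∈ Finset.Icc ((j + 1) / 2) j, (window β i : ℝ) := by
        refine Finset.sum_le_sum fun i hi => le_trans ?_ (Nat.le_ceil _)
        refine Real.rpow_le_rpow hj2.le ?_ hβ.le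
        rw [div_le_iff₀ two_pos]
        have := (Finset.mem_Icc.mp hi).1
        exact_mod_cast (by omega : j ≤ i * 2)
    _ ≤ ∑ i ∈ Finset.Icc 1 j, (window β i : ℝ) :=
        Finset.sum_le_sum_of_subset_of_nonneg (Finset.Icc_subset_Icc_left (by omega))
          fun _ _ _ => Nat.cast_nonneg _
    _ = adaptTime β j := by simp [adaptTime]

lemma le_of_adaptTime_le (hβ : 0 < β) {j n : ℕ} (h : adaptTime β j ≤ n) :
    (j : ℝ) ≤ 2 * (n : ℝ) ^ (1 / (1 + β)) := by
  have h1 : ((j : ℝ) / 2) ^ (1 + β) ≤ n :=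
    (half_rpow_le_adaptTime hβ j).trans (by exact_mod_cast h)
  have h2 := Real.rpow_le_rpow (by positivity) h1 (by positivity : 0 ≤ 1 / (1 + β))
  rw [← Real.rpow_mul (by positivity), mul_one_div_cancel (by linarith), Real.rpow_one] at h2
  linarith

open Classical in
/-- A sequence that is constant on the windows changes at most `2 n ^ (1 / (1 + β))` times up to
time `n`. -/
lemma card_filter_ne_le {I : Type*} (hβ : 0 < β) {s : ℕ → I}
    (hs : ∀ j i₁ i₂ : ℕ, i₁ ∈ Set.Ico (adaptTime β j) (adaptTime β (j + 1)) →
      i₂ ∈ Set.Ico (adaptTime β j) (adaptTime β (j + 1)) → s i₁ = s i₂) (n : ℕ) :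
    (((Finset.Icc 1 n).filter fun i => s i ≠ s (i - 1)).card : ℝ)
      ≤ 2 * (n : ℝ) ^ (1 / (1 + β)) := by
  set N := ⌊2 * (n : ℝ) ^ (1 / (1 + β))⌋₊ with hN
  have hsub : ((Finset.Icc 1 n).filter fun i => s i ≠ s (i - 1))
      ⊆ (Finset.Icc 1 N).image (adaptTime β) := by
    intro i hi
    obtain ⟨hi1, hne⟩ := Finset.mem_filter.mp hi
    obtain ⟨hi1, hin⟩ := Finset.mem_Icc.mp hi1
    obtain ⟨j, hj1, hj2⟩ := exists_adaptTime_le_lt (β := β) i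
    have hji : adaptTime β j = i := by
      by_contra h
      exact hne (hs j i (i - 1) ⟨hj1, hj2⟩ ⟨by omega, by omega⟩)
    refine Finset.mem_image.mpr ⟨j, Finset.mem_Icc.mpr ⟨?_, ?_⟩, hji⟩
    · rcases Nat.eq_zero_or_pos j with rfl | h
      · rw [adaptTime_zero] at hji; omega
      · exact h
    · exact Nat.le_floor (le_of_adaptTime_le hβ (hji.le.trans hin))
  have hcard := (Finset.card_le_card hsub).trans Finset.card_image_le
  rw [Nat.card_Icc, Nat.add_sub_cancel] at hcard
  exact (Nat.cast_le.mpr hcard).trans (Nat.floor_le (by positivity))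

/-- Summation by parts: the sum telescopes apart from the times at which the parameter changes. -/
lemma abs_sum_sub_le {E I : Type*} (hβ : 0 < β) {s : ℕ → I}
    (hs : ∀ j i₁ i₂ : ℕ, i₁ ∈ Set.Ico (adaptTime β j) (adaptTime β (j + 1)) →
      i₂ ∈ Set.Ico (adaptTime β j) (adaptTime β (j + 1)) → s i₁ = s i₂)
    (x : ℕ → E) {g : E × I → ℝ} {G : ℝ} (hG : ∀ p, |g p| ≤ G) (n : ℕ) :
    |∑ i ∈ Finset.Icc 1 n, (g (x i, s i) - g (x (i + 1), s i))|
      ≤ 2 * G + 2 * (n : ℝ) ^ (1 / (1 + β)) * (2 * G) := by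
  classical
  have hG2 : ∀ p q, |g p - g q| ≤ 2 * G := fun p q => by
    linarith [abs_sub (g p) (g q), hG p, hG q]
  have hG0 : 0 ≤ 2 * G := (abs_nonneg _).trans (hG2 (x 0, s 0) (x 0, s 0))
  have htel : ∑ i ∈ Finset.Icc 1 n, (g (x i, s i) - g (x (i + 1), s i))
      = (g (x 1, s 0) - g (x (n + 1), s n))
        + ∑ i ∈ Finset.Icc 1 n, (g (x i, s i) - g (x i, s (i - 1))) := by
    induction n with
    | zero => simp
    | succ n ih =>
      rw [Finset.sum_Icc_succ_top (by omega), Finset.sum_Icc_succ_top (by omega), ih,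
        Nat.add_sub_cancel]
      ring
  have hsum : |∑ i ∈ Finset.Icc 1 n, (g (x i, s i) - g (x i, s (i - 1)))|
      ≤ 2 * (n : ℝ) ^ (1 / (1 + β)) * (2 * G) := by
    have hfil : ∑ i ∈ Finset.Icc 1 n, (g (x i, s i) - g (x i, s (i - 1)))
        = ∑ i ∈ (Finset.Icc 1 n).filter (fun i => s i ≠ s (i - 1)),
          (g (x i, s i) - g (x i, s (i - 1))) := by
      refine (Finset.sum_filter_of_ne (p := fun i => s i ≠ s (i - 1))
        fun i _ hne heq => hne ?_).symm
      rw [heq, sub_self]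
    rw [hfil]
    refine (Finset.abs_sum_le_sum_abs _ _).trans ?_
    refine (Finset.sum_le_card_nsmul _ _ _ fun i _ => hG2 _ _).trans ?_
    rw [nsmul_eq_mul]
    exact mul_le_mul_of_nonneg_right (card_filter_ne_le hβ hs n) hG0
  rw [htel]
  exact (abs_add_le _ _).trans (add_le_add (hG2 _ _) hsum)

end AdaptTime

/-! ### Conditional expectations along the chain -/

section Chain

lemma measurable_history_state {Ω E I : Type*} [mE : MeasurableSpace E]
    [mI : MeasurableSpace I] {Y : ℕ → Ω → E} {Γ : ℕ → Ω → I} {j n : ℕ} (hj : j ≤ n) :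
    Measurable[history Y Γ n] (Y j) :=
  (comap_measurable (Y j)).mono (le_iSup₂_of_le j hj le_sup_left) le_rfl

lemma measurable_history_param {Ω E I : Type*} [mE : MeasurableSpace E]
    [mI : MeasurableSpace I] {Y : ℕ → Ω → E} {Γ : ℕ → Ω → I} {j n : ℕ} (hj : j ≤ n) :
    Measurable[history Y Γ n] (Γ j) :=
  (comap_measurable (Γ j)).mono (le_iSup₂_of_le j hj le_sup_right) le_rfl

variable {Ω E I : Type*} [mΩ : MeasurableSpace Ω] [mE : MeasurableSpace E]
  [mI : MeasurableSpace I] {Pr : Measure Ω} {κ : Kernel (E × I) E} {β : ℝ} {y₀ : E} {γ₀ : I}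
  {Y : ℕ → Ω → E} {Γ : ℕ → Ω → I}

lemma IsAIRChain.history_le (h : IsAIRChain Pr κ β y₀ γ₀ Y Γ) (n : ℕ) : history Y Γ n ≤ mΩ :=
  iSup₂_le fun j _ => sup_le (h.measurable_state j).comap_le (h.measurable_param j).comap_le

/-- On every event of the past, the joint law of the current pair and the next state is the
composition-product of the law of the current pair with `κ`. -/
lemma IsAIRChain.map_restrict_eq_compProd [IsProbabilityMeasure Pr] [IsMarkovKernel κ]
    (h : IsAIRChain Pr κ β y₀ γ₀ Y Γ) (n : ℕ) {A : Set Ω} (hA : MeasurableSet[history Y Γ n] A) :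
    (Pr.restrict A).map (fun ω => ((Y n ω, Γ n ω), Y (n + 1) ω))
      = ((Pr.restrict A).map fun ω => (Y n ω, Γ n ω)) ⊗ₘ κ := by
  have hp : Measurable fun ω => (Y n ω, Γ n ω) :=
    (h.measurable_state n).prodMk (h.measurable_param n)
  have hpF : Measurable[history Y Γ n] fun ω => (Y n ω, Γ n ω) :=
    (measurable_history_state le_rfl).prodMk (measurable_history_param le_rfl)
  have hY := h.measurable_state (n + 1)
  refine Measure.ext_prod fun {S B} hS hB => ?_
  rw [Measure.map_apply (hp.prodMk hY) (hS.prod hB), Measure.compProd_apply_prod hS hB,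
    setLIntegral_map hS (κ.measurable_coe hB) hp]
  set D : Set Ω := (fun ω => (Y n ω, Γ n ω)) ⁻¹' S ∩ A with hD
  have hDF : MeasurableSet[history Y Γ n] D := (hpF hS).inter hA
  have hDm : MeasurableSet D := h.history_le n _ hDF
  have hBm : MeasurableSet (Y (n + 1) ⁻¹' B) := hY hB
  have hκ : Measurable fun ω => (κ (Y n ω, Γ n ω)) B := (κ.measurable_coe hB).comp hp
  have e1 : (Pr.restrict A) ((fun ω => ((Y n ω, Γ n ω), Y (n + 1) ω)) ⁻¹' (S ×ˢ B))
      = Pr (Y (n + 1) ⁻¹' B ∩ D) := by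
    rw [Measure.restrict_apply ((hp.prodMk hY) (hS.prod hB))]
    congr 1
    ext ω
    simp only [hD, Set.mem_inter_iff, Set.mem_preimage, Set.mem_prod]
    tauto
  have e2 : (Pr.restrict A).restrict ((fun ω => (Y n ω, Γ n ω)) ⁻¹' S) = Pr.restrict D := by
    rw [Measure.restrict_restrict (hp hS)]
  rw [e1, e2]
  have hint : Integrable ((Y (n + 1) ⁻¹' B).indicator fun _ => (1 : ℝ)) Pr :=
    (integrable_const 1).indicator hBm
  have h1 := setIntegral_condExp (μ := Pr) (h.history_le n) hint hDF
  rw [setIntegral_congr_ae hDm ((h.transition n B hB).mono fun ω hω _ => hω),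
    integral_indicator_const _ hBm, measureReal_restrict_apply hBm, smul_eq_mul, mul_one] at h1
  -- The transition property is stated for real-valued probabilities; pass to `ℝ≥0∞`.
  have hfin : ∀ᵐ ω ∂Pr.restrict D, (κ (Y n ω, Γ n ω)) B < ∞ :=
    ae_of_all _ fun ω => measure_lt_top _ _
  have h2 : ∫ ω in D, (κ (Y n ω, Γ n ω)).real B ∂Pr
      = (∫⁻ ω in D, (κ (Y n ω, Γ n ω)) B ∂Pr).toReal :=
    integral_toReal hκ.aemeasurable hfin
  rw [h2, measureReal_def] at h1
  refine ((ENNReal.toReal_eq_toReal_iff' ?_ (measure_ne_top _ _)).mp h1).symm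
  refine ((lintegral_mono fun ω => prob_le_one).trans_lt ?_).ne
  simp

/-- The defining property of the chain, extended from events to bounded functions of the next
state and the current parameter. -/
lemma IsAIRChain.condExp_next [IsProbabilityMeasure Pr] [IsMarkovKernel κ]
    (h : IsAIRChain Pr κ β y₀ γ₀ Y Γ) (n : ℕ) {g : E × I → ℝ} (hg : Measurable g) {G : ℝ}
    (hG : ∀ p, |g p| ≤ G) :
    Pr[fun ω => g (Y (n + 1) ω, Γ n ω) | history Y Γ n]
      =ᵐ[Pr] fun ω => transitionOp κ g (Y n ω, Γ n ω) := by
  have hp : Measurable fun ω => (Y n ω, Γ n ω) :=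
    (h.measurable_state n).prodMk (h.measurable_param n)
  have hpF : Measurable[history Y Γ n] fun ω => (Y n ω, Γ n ω) :=
    (measurable_history_state le_rfl).prodMk (measurable_history_param le_rfl)
  have hY := h.measurable_state (n + 1)
  have hT := measurable_transitionOp (κ := κ) hg
  refine (ae_eq_condExp_of_forall_setIntegral_eq (h.history_le n) ?_ ?_ ?_ ?_).symm
  · exact integrable_of_measurable_of_abs_le (hg.comp (hY.prodMk (h.measurable_param n)))
      fun ω => hG _
  · intro A _ _
    exact (integrable_of_measurable_of_abs_le (hT.comp hp)
      fun ω => abs_transitionOp_le hG _).integrableOn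
  · intro A hA _
    have hq : Measurable fun q : (E × I) × E => g (q.2, q.1.2) := hg.comp (by fun_prop)
    have h1 : ∫ ω in A, g (Y (n + 1) ω, Γ n ω) ∂Pr
        = ∫ q, g (q.2, q.1.2) ∂(Pr.restrict A).map
          (fun ω => ((Y n ω, Γ n ω), Y (n + 1) ω)) := by
      rw [integral_map (hp.prodMk hY).aemeasurable hq.aestronglyMeasurable]
    rw [h1, h.map_restrict_eq_compProd n hA, Measure.integral_compProd
      (integrable_of_measurable_of_abs_le hq fun q => hG _),
      integral_map hp.aemeasurable]
    · rfl
    · exact hT.aestronglyMeasurable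
  · exact (hT.comp hpF).stronglyMeasurable.aestronglyMeasurable

/-- The law of large numbers along the chain for a function that admits bounded solutions of the
Poisson equations. -/
theorem IsAIRChain.ae_tendsto_of_poisson [IsProbabilityMeasure Pr] [IsMarkovKernel κ]
    (h : IsAIRChain Pr κ β y₀ γ₀ Y Γ) (hβ : β ∈ Set.Ioo (0 : ℝ) 1) {g u : E × I → ℝ}
    (hg : Measurable g) {G : ℝ} (hG : ∀ p, |g p| ≤ G)
    (hgu : ∀ p, g p - transitionOp κ g p = u p) {ε : ℝ} (hε : 1 / (1 + β) - 1 / 2 < ε) :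
    ∀ᵐ ω ∂Pr, Tendsto (fun n : ℕ => 1 / (n : ℝ) ^ (1 / 2 + ε) *
      ∑ j ∈ Finset.Icc 1 n, u (Y j ω, Γ j ω)) atTop (𝓝 0) := by
  have hε0 : 0 < ε := by
    have : 1 / 2 < 1 / (1 + β) := one_div_lt_one_div_of_lt (by linarith [hβ.1]) (by linarith [hβ.2])
    linarith
  have hT := measurable_transitionOp (κ := κ) hg
  set ξ : ℕ → Ω → ℝ := fun i ω =>
    g (Y (i + 1) ω, Γ i ω) - transitionOp κ g (Y i ω, Γ i ω) with hξ
  have hmeas : ∀ i n, i < n → Measurable[history Y Γ n] (ξ i) := fun i n hi =>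
    (hg.comp ((measurable_history_state hi).prodMk (measurable_history_param hi.le))).sub
      (hT.comp ((measurable_history_state hi.le).prodMk (measurable_history_param hi.le)))
  have hb : ∀ n ω, |ξ n ω| ≤ 2 * G := fun n ω => by
    have h1 := hG (Y (n + 1) ω, Γ n ω)
    have h2 := abs_transitionOp_le (κ := κ) hG (Y n ω, Γ n ω)
    exact (abs_sub _ _).trans (by linarith)
  have h0 : ∀ n, Pr[ξ n | history Y Γ n] =ᵐ[Pr] 0 := by
    intro n
    have hpF : Measurable[history Y Γ n] fun ω => (Y n ω, Γ n ω) :=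
      (measurable_history_state le_rfl).prodMk (measurable_history_param le_rfl)
    have hp := hpF.mono (h.history_le n) le_rfl
    have i1 : Integrable (fun ω => g (Y (n + 1) ω, Γ n ω)) Pr :=
      integrable_of_measurable_of_abs_le
        (hg.comp ((h.measurable_state _).prodMk (h.measurable_param n))) fun ω => hG _
    have i2 : Integrable (fun ω => transitionOp κ g (Y n ω, Γ n ω)) Pr :=
      integrable_of_measurable_of_abs_le (hT.comp hp) fun ω => abs_transitionOp_le hG _
    have hc := condExp_of_stronglyMeasurable (μ := Pr) (h.history_le n)
      (hT.comp hpF).stronglyMeasurable i2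
    filter_upwards [condExp_sub i1 i2 (history Y Γ n), h.condExp_next n hg hG] with ω h1 h2
    have h3 := congrFun hc ω
    simp only [Function.comp_def] at h3
    refine h1.trans ?_
    rw [Pi.sub_apply, h2, h3]
    simp
  have hmart := ae_tendsto_martingale_div_rpow (μ := Pr) (𝓕 := fun n => history Y Γ (n + 1))
    (ξ := fun n => ξ (n + 1)) (fun n => h.history_le (n + 1))
    (fun i n hi => hmeas (i + 1) (n + 1) (by omega)) (fun n => hb (n + 1))
    (fun n => h0 (n + 1)) hε0
  filter_upwards [hmart] with ω hω
  have hR : Tendsto (fun n : ℕ => 1 / (n : ℝ) ^ (1 / 2 + ε) *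
      ∑ i ∈ Finset.Icc 1 n, (g (Y i ω, Γ i ω) - g (Y (i + 1) ω, Γ i ω))) atTop (𝓝 0) := by
    have l1 : Tendsto (fun n : ℕ => (n : ℝ) ^ (-(1 / 2 + ε))) atTop (𝓝 0) :=
      (tendsto_rpow_neg_atTop (by linarith)).comp tendsto_natCast_atTop_atTop
    have l2 : Tendsto (fun n : ℕ => (n : ℝ) ^ (-(1 / 2 + ε - 1 / (1 + β)))) atTop (𝓝 0) :=
      (tendsto_rpow_neg_atTop (by linarith)).comp tendsto_natCast_atTop_atTop
    have l3 := (l1.const_mul (2 * G)).add (l2.const_mul (2 * (2 * G)))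
    rw [mul_zero, mul_zero, add_zero] at l3
    refine squeeze_zero_norm' ?_ l3
    filter_upwards [eventually_gt_atTop 0] with n hn
    have hn0 : (0 : ℝ) < n := by exact_mod_cast hn
    have hbound := abs_sum_sub_le hβ.1 (s := fun i => Γ i ω)
      (fun j i₁ i₂ h1 h2 => congrFun (h.const_between j i₁ i₂ h1 h2) ω) (fun i => Y i ω) hG n
    have e1 : 1 / (n : ℝ) ^ (1 / 2 + ε) = (n : ℝ) ^ (-(1 / 2 + ε)) := by
      rw [Real.rpow_neg hn0.le, one_div]
    have e2 : (n : ℝ) ^ (-(1 / 2 + ε - 1 / (1 + β)))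
        = (n : ℝ) ^ (-(1 / 2 + ε)) * (n : ℝ) ^ (1 / (1 + β)) := by
      rw [← Real.rpow_add hn0]; ring_nf
    rw [Real.norm_eq_abs, e1, abs_mul, abs_of_pos (Real.rpow_pos_of_pos hn0 _), e2]
    refine (mul_le_mul_of_nonneg_left hbound (Real.rpow_pos_of_pos hn0 _).le).trans (le_of_eq ?_)
    ring
  have hlim := hω.add hR
  rw [add_zero] at hlim
  refine hlim.congr fun n => ?_
  rw [← mul_add]
  congr 1
  have hshift : ∑ i ∈ Finset.range n, ξ (i + 1) ω = ∑ i ∈ Finset.Icc 1 n, ξ i ω := by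
    rw [← Finset.Ico_add_one_right_eq_Icc, Finset.sum_Ico_eq_sum_range, Nat.add_sub_cancel]
    simp only [add_comm 1]
  rw [hshift, ← Finset.sum_add_distrib]
  refine Finset.sum_congr rfl fun i _ => ?_
  rw [← hgu]
  simp only [hξ]
  ring

end Chain

end AIRMCMC

theorem mainTheorem3
    {X Φ I Ω : Type*}
    [MeasurableSpace X] [StandardBorelSpace X]
    [MeasurableSpace Φ] [StandardBorelSpace Φ]
    [TopologicalSpace (X × Φ)] [PolishSpace (X × Φ)] [BorelSpace (X × Φ)]
    [MeasurableSpace I]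
    [MeasurableSpace Ω] (Pr : Measure Ω) [IsProbabilityMeasure Pr]
    (d : X × Φ → X × Φ → ℝ≥0) (hd : AIRMCMC.IsDistanceLike d)
    (κ : Kernel ((X × Φ) × I) (X × Φ)) [IsMarkovKernel κ]
    (ν : Measure X) [IsProbabilityMeasure ν]
    (π : I → Measure (X × Φ)) [∀ γ, IsProbabilityMeasure (π γ)]
    (hπ : ∀ γ, (π γ).map Prod.fst = ν)
    (hcontr : AIRMCMC.ContractionAssumption d κ π)
    (hecc : AIRMCMC.BoundedEccentricity d π)
    (f : X → ℝ) (hf : Measurable f)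
    (hbdd : ∃ C : ℝ, ∀ y, |AIRMCMC.augment Φ f y| ≤ C)
    (L : ℝ) (hL : 0 < L) (hLip : AIRMCMC.IsLipschitzWrt d L (AIRMCMC.augment Φ f))
    (β : ℝ) (hβ : β ∈ Set.Ioo (0 : ℝ) 1)
    (y₀ : X × Φ) (γ₀ : I) (Y : ℕ → Ω → X × Φ) (Γ : ℕ → Ω → I)
    (hchain : AIRMCMC.IsAIRChain Pr κ β y₀ γ₀ Y Γ)
    (ε : ℝ) (hε : 1 / (1 + β) - 1 / 2 < ε) :
    ∀ᵐ ω ∂Pr, Tendsto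
      (fun n : ℕ => 1 / (n : ℝ) ^ (1 / 2 + ε) *
        ∑ j ∈ Finset.Icc 1 n, (f (Y j ω).1 - ∫ x, f x ∂ν))
      atTop (𝓝 0) := by
  obtain ⟨C, hC⟩ := hbdd
  set a : ℝ := ∫ x, f x ∂ν with ha
  set u : (X × Φ) × I → ℝ := fun p => f p.1.1 - a with hu
  have hum : Measurable u := by fun_prop
  have hub : ∀ p, |u p| ≤ C + |a| := fun p =>
    (abs_sub _ _).trans (add_le_add (hC p.1) le_rfl)
  have huL : ∀ γ, AIRMCMC.IsLipschitzWrt d (⟨L, hL.le⟩ : ℝ≥0) fun y => u (y, γ) := fun γ x y => by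
    have := hLip x y
    simpa [hu, AIRMCMC.augment] using this
  have hu0 : ∀ γ, ∫ y, u (y, γ) ∂π γ = 0 := fun γ => by
    have hint : Integrable (fun y : X × Φ => f y.1) (π γ) :=
      AIRMCMC.integrable_of_measurable_of_abs_le (hf.comp measurable_fst) hC
    have hmap : ∫ y, f y.1 ∂π γ = a := by
      rw [ha, ← hπ γ, integral_map measurable_fst.aemeasurable hf.aestronglyMeasurable]
    simp only [hu]
    rw [integral_sub hint (integrable_const _), hmap]
    simp
  obtain ⟨g, hgm, ⟨G, hG⟩, hgu⟩ := AIRMCMC.exists_poisson_solution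
    (fun x y => (hd.eq_zero_iff x y).mp) hcontr hecc hum hub huL hu0
  exact hchain.ae_tendsto_of_poisson hβ hgm hG hgu hε
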